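/- Let $G=(V,E)$ be a directed graph on $V=\{1,\dots,n\}$ without loops and without parallel edges, in which every vertex $i$ has a nonempty set $N_i^+$ of out-neighbours, and let $\mu$ be a probability distribution on $V$. In the \emph{deterministic buck-passing game}, each player $i\in V$ chooses an out-neighbour $s_i\in N_i^+$; a buck is given at time $0$ to a vertex $X_0$ with law $\mu$ and then passed on by the rule $X_{t+1}=s_{X_t}$. In the \emph{stochastic buck-passing game}, each player $i$ chooses a probability vector $\pi_i$ on $V$ supported on $N_i^+$, and $(X_t)_{t\ge 0}$ is the Markov chain with initial law $\mu$ and transition matrix $\pi=(\pi_{ij})$. Write $\mathcal S$ and $\Sigma$ for the respective sets of strategy profiles. In both games player $i$ pays the cost $$c_i=\mathbb E\Big[\lim_{T\to\infty}\frac1T\sum_{t=1}^T \mathbf 1_{\{X_t=i\}}\Big].$$ For $\mathcal X\in\{\mathcal S,\Sigma\}$ let $\mathrm{NE}(\mathcal X)$ be the set of profiles in $\mathcal X$ from which no player can strictly lower her own cost by a unilateral deviation within the same game, let $\mathrm{SC}(x)=\max_{i\in V}c_i(x)$ be the Rawlsian social cost, and put $$\mathrm{PoA}(\mathcal X)=\frac{\sup_{x\in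 \mathrm{NE}(\mathcal X)}\mathrm{SC}(x)}{\inf_{x\in\mathcal X}\mathrm{SC}(x)},\qquad \mathrm{PoS}(\mathcal X)=\frac{\inf_{x\in \mathrm{NE}(\mathcal X)}\mathrm{SC}(x)}{\inf_{x\in\mathcal X}\mathrm{SC}(x)}.$$ Then, for every such $(G,\mu)$, these quantities are well defined (the limits above exist, almost surely in the stochastic game, and $\mathrm{NE}(\mathcal S)$ and $\mathrm{NE}(\Sigma)$ are nonempty), and $$\text{(a)}\quad \mathrm{PoS}(\mathcal S)\le \mathrm{PoA}(\mathcal S)\le \frac n2,\qquad\qquad \text{(b)}\quad \mathrm{PoS}(\Sigma)\le \mathrm{PoA}(\Sigma)\le \frac n2 .$$ Moreover, for every $n\ge 4$ there is an instance $(G,\mu)$ with $n$ players such that $\mathrm{PoS}(\mathcal S)=\mathrm{PoA}(\mathcal S)=\mathrm{PoS}(\Sigma)=\mathrm{PoA}(\Sigma)=\frac n2$. -/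

import Mathlib

open MeasureTheory ProbabilityTheory Filter

noncomputable section

namespace BuckPassing

/-! ### Finite cost games and Rawlsian price of anarchy / stability -/

section CostGame

variable {ι : Type*} [DecidableEq ι] {A : ι → Type*}

/-- The set of (pure) Nash equilibria of a cost game: profiles from which no player can strictly
lower her own cost by a unilateral deviation. -/
def nashEquilibria (c : (∀ i, A i) → ι → ℝ) : Set (∀ i, A i) :=
  {s | ∀ (i : ι) (a : A i), ¬ c (Function.update s i a) i < c s i}

/-- Rawlsian social cost of a profile: the largest cost paid by a player. -/
def socialCost (c : (∀ i, A i) → ι → ℝ) (s : ∀ i, A i) : ℝ :=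
  ⨆ i, c s i

/-- Price of anarchy: supremum of the social cost over the equilibria, divided by the infimum of
the social cost over all profiles. -/
def priceOfAnarchy (c : (∀ i, A i) → ι → ℝ) : ℝ :=
  sSup (socialCost c '' nashEquilibria c) / sInf (Set.range (socialCost c))

/-- Price of stability: infimum of the social cost over the equilibria, divided by the infimum of
the social cost over all profiles. -/
def priceOfStability (c : (∀ i, A i) → ι → ℝ) : ℝ :=
  sInf (socialCost c '' nashEquilibria c) / sInf (Set.range (socialCost c))

end CostGame

/-- The data of a buck-passing game with `n` players: a directed graph without loops on the
players, in which every vertex has at least one out-neighbour, and the law of the initial owner of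
the buck. -/
structure Game (n : ℕ) where
  graph : Digraph (Fin n)
  loopless : ∀ i, ¬ graph.Adj i i
  exists_out : ∀ i, ∃ j, graph.Adj i j
  prior : PMF (Fin n)

/-- Fraction of the times `1, …, T` at which player `i` owns the buck, when `x t` is the owner at
time `t`. -/
def frequency {n : ℕ} (x : ℕ → Fin n) (i : Fin n) (T : ℕ) : ℝ :=
  (1 / (T : ℝ)) * ∑ t ∈ Finset.Icc 1 T, if x t = i then 1 else 0

/-- Asymptotic fraction of time that player `i` owns the buck along `x`. -/
def asymptoticFrequency {n : ℕ} (x : ℕ → Fin n) (i : Fin n) : ℝ :=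
  limUnder atTop (frequency x i)

namespace Game

variable {n : ℕ} (G : Game n)

/-! ### The deterministic game -/

/-- Deterministic strategies of player `i`: her out-neighbours. -/
abbrev DetStrategy (i : Fin n) : Type := {j : Fin n // G.graph.Adj i j}

/-- The trajectory of the buck under the profile `s` when it is first given to `v`. -/
def detPath (s : ∀ i, G.DetStrategy i) (v : Fin n) (t : ℕ) : Fin n :=
  (fun i => (s i : Fin n))^[t] v

/-- Cost of player `i` in the deterministic game: the expectation, over the initial draw, of the
asymptotic frequency of times at which she has the buck. -/
def detCost (s : ∀ i, G.DetStrategy i) (i : Fin n) : ℝ :=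
  ∫ v, asymptoticFrequency (G.detPath s v) i ∂G.prior.toMeasure

/-! ### The stochastic game -/

/-- Stochastic strategies of player `i`: probability vectors supported on her out-neighbours. -/
abbrev StochStrategy (i : Fin n) : Type :=
  {p : PMF (Fin n) // ∀ j, ¬ G.graph.Adj i j → p j = 0}

/-- The one-step transition kernel whose row at `i` is the strategy of player `i`. -/
def transition (π : ∀ i, G.StochStrategy i) : Kernel (Fin n) (Fin n) :=
  Kernel.ofFunOfCountable fun i => (π i).1.toMeasure

instance (π : ∀ i, G.StochStrategy i) : IsMarkovKernel (G.transition π) :=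
  ⟨fun i => inferInstanceAs (IsProbabilityMeasure (π i).1.toMeasure)⟩

/-- The law, on the space of trajectories, of the time-homogeneous Markov chain with initial law
`G.prior` and transition matrix `π`. -/
def pathMeasure (π : ∀ i, G.StochStrategy i) : Measure (ℕ → Fin n) :=
  Kernel.trajMeasure (X := fun _ => Fin n) G.prior.toMeasure fun t =>
    (G.transition π).comap (fun h : ((i : Finset.Iic t) → Fin n) => h ⟨t, by simp⟩)
      (measurable_pi_apply _)

/-- Cost of player `i` in the stochastic game: the expectation, over the Markov chain, of the
asymptotic frequency of times at which she has the buck. -/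
def stochCost (π : ∀ i, G.StochStrategy i) (i : Fin n) : ℝ :=
  ∫ x, asymptoticFrequency x i ∂G.pathMeasure π

end Game

end BuckPassing

end

namespace BuckPassing

/-- Kronecker's lemma for the weights `1 / (k + 1)`. -/
lemma tendsto_average_zero_of_sum_div {d : ℕ → ℝ} {l : ℝ}
    (h : Tendsto (fun T => ∑ k ∈ Finset.range T, ((k : ℝ) + 1)⁻¹ * d k) atTop (nhds l)) :
    Tendsto (fun T : ℕ => (T : ℝ)⁻¹ * ∑ k ∈ Finset.range T, d k) atTop (nhds 0) := by
  set S : ℕ → ℝ := fun T => ∑ k ∈ Finset.range T, ((k : ℝ) + 1)⁻¹ * d k with hS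
  have key : ∀ T : ℕ, ∑ k ∈ Finset.range T, d k
      = T * S T - ∑ k ∈ Finset.range T, S k := by
    intro T
    induction T with
    | zero => simp
    | succ T ih =>
      have h1 : S (T + 1) = S T + ((T : ℝ) + 1)⁻¹ * d T := Finset.sum_range_succ _ _
      have h2 : ((T : ℝ) + 1) ≠ 0 := by positivity
      rw [Finset.sum_range_succ, ih, Finset.sum_range_succ, h1]
      push_cast
      field_simp
      ring
  have h3 := h.sub h.cesaro
  rw [sub_self] at h3
  refine h3.congr' ?_
  filter_upwards [eventually_gt_atTop 0] with T hT
  have h2 : (T : ℝ) ≠ 0 := by positivity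
  rw [key]
  field_simp

/-- A power-bounded operator on a finite-dimensional space decomposes every vector into a fixed
vector and a coboundary. -/
lemma exists_fixed_add_coboundary {ι : Type*} [Fintype ι]
    (P : (ι → ℝ) →ₗ[ℝ] (ι → ℝ)) (hP : ∀ g, ‖P g‖ ≤ ‖g‖) (f : ι → ℝ) :
    ∃ h g : ι → ℝ, P h = h ∧ f = h + (g - P g) := by
  set A : (ι → ℝ) →ₗ[ℝ] (ι → ℝ) := LinearMap.id - P with hA
  have hdisj : Disjoint A.ker A.range := by
    rw [Submodule.disjoint_def]
    rintro h hk ⟨g, hg⟩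
    have hk' : P h = h := by
      have : h - P h = 0 := by simpa [hA] using hk
      exact (sub_eq_zero.mp this).symm
    have hg' : P g = g - h := by
      have : g - P g = h := by simpa [hA] using hg
      rw [← this]; abel
    have hpow : ∀ k : ℕ, (P^[k]) g = g - (k : ℝ) • h := by
      intro k
      induction k with
      | zero => simp
      | succ k ih =>
        rw [Function.iterate_succ_apply', ih, map_sub, map_smul, hk', hg']
        push_cast
        rw [add_smul, one_smul]; abel
    have hbd : ∀ k : ℕ, ‖(P^[k]) g‖ ≤ ‖g‖ := by
      intro k
      induction k with
      | zero => simp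
      | succ k ih =>
        rw [Function.iterate_succ_apply']
        exact (hP _).trans ih
    have hle : ∀ k : ℕ, (k : ℝ) * ‖h‖ ≤ 2 * ‖g‖ := by
      intro k
      have h1 : (k : ℝ) • h = g - (P^[k]) g := by rw [hpow]; abel
      have h2 : ‖(k : ℝ) • h‖ = k * ‖h‖ := by rw [norm_smul]; simp
      rw [← h2, h1]
      have := norm_sub_le g ((P^[k]) g)
      linarith [hbd k]
    by_contra hne
    have hpos : 0 < ‖h‖ := norm_pos_iff.mpr hne
    obtain ⟨k, hk⟩ := exists_nat_gt (2 * ‖g‖ / ‖h‖)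
    rw [div_lt_iff₀ hpos] at hk
    linarith [hle k]
  have hcompl : IsCompl A.ker A.range := by
    rw [Submodule.isCompl_iff_disjoint]
    · exact hdisj
    · rw [add_comm, LinearMap.finrank_range_add_finrank_ker]
  obtain ⟨h, hh, u, ⟨g, rfl⟩, hf⟩ := (Submodule.sup_eq_top_iff _ _).mp hcompl.sup_eq_top f
  refine ⟨h, g, ?_, ?_⟩
  · have : h - P h = 0 := by simpa [hA] using hh
    exact (sub_eq_zero.mp this).symm
  · simpa [hA] using hf

namespace Game

variable {n : ℕ} (G : Game n) (π : ∀ i, G.StochStrategy i)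

instance : IsProbabilityMeasure (G.pathMeasure π) := by
  unfold pathMeasure; infer_instance

/-- The expectation operator `(P g) i = ∑ j, π_{ij} g j`. -/
def expectationOp : (Fin n → ℝ) →ₗ[ℝ] (Fin n → ℝ) where
  toFun g i := ∑ j, ((π i).1 j).toReal * g j
  map_add' g g' := by ext i; simp [mul_add, Finset.sum_add_distrib]
  map_smul' c g := by
    ext i
    simp only [Pi.smul_apply, smul_eq_mul, RingHom.id_apply, Finset.mul_sum]
    exact Finset.sum_congr rfl fun j _ => by ring

lemma expectationOp_apply (g : Fin n → ℝ) (i : Fin n) :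
    G.expectationOp π g i = ∑ j, ((π i).1 j).toReal * g j := rfl

lemma sum_strategy_toReal (i : Fin n) : ∑ j, ((π i).1 j).toReal = 1 := by
  rw [← ENNReal.toReal_sum fun j _ => (π i).1.apply_ne_top j, ← tsum_fintype (L := .unconditional _),
    (π i).1.tsum_coe, ENNReal.toReal_one]

lemma norm_expectationOp_le (g : Fin n → ℝ) : ‖G.expectationOp π g‖ ≤ ‖g‖ := by
  rw [pi_norm_le_iff_of_nonneg (norm_nonneg _)]
  intro i
  rw [expectationOp_apply]
  calc ‖∑ j, ((π i).1 j).toReal * g j‖ ≤ ∑ j, ‖((π i).1 j).toReal * g j‖ := norm_sum_le _ _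
    _ ≤ ∑ j, ((π i).1 j).toReal * ‖g‖ := by
        refine Finset.sum_le_sum fun j _ => ?_
        rw [norm_mul, Real.norm_of_nonneg ENNReal.toReal_nonneg]
        gcongr
        exact norm_le_pi_norm g j
    _ = ‖g‖ := by rw [← Finset.sum_mul, sum_strategy_toReal, one_mul]

lemma integrable_frestrictLe_comp (t : ℕ) (φ : ((i : Finset.Iic t) → Fin n) → ℝ) :
    Integrable (fun x => φ (Preorder.frestrictLe t x)) (G.pathMeasure π) := by
  have h : Integrable φ ((G.pathMeasure π).map (Preorder.frestrictLe t)) := .of_finite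
  exact h.comp_measurable (Preorder.measurable_frestrictLe t)

/-- One step of the Markov chain, conditionally on the past. -/
lemma integral_step (t : ℕ) (φ : ((i : Finset.Iic t) → Fin n) → Fin n → ℝ) :
    ∫ x, φ (Preorder.frestrictLe t x) (x (t + 1)) ∂G.pathMeasure π
      = ∫ x, G.expectationOp π (φ (Preorder.frestrictLe t x)) (x t) ∂G.pathMeasure π := by
  have hstep := Kernel.map_frestrictLe_trajMeasure_compProd_eq_map_trajMeasure
    (X := fun _ => Fin n) (μ₀ := G.prior.toMeasure) (κ := fun t =>
    (G.transition π).comap (fun h : ((i : Finset.Iic t) → Fin n) => h ⟨t, by simp⟩)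
      (measurable_pi_apply _)) (a := t)
  change (G.pathMeasure π).map _ ⊗ₘ _ = (G.pathMeasure π).map _ at hstep
  have h1 : ∫ x, φ (Preorder.frestrictLe t x) (x (t + 1)) ∂G.pathMeasure π
      = ∫ p, φ p.1 p.2 ∂((G.pathMeasure π).map
        (fun x => (Preorder.frestrictLe t x, x (t + 1)))) := by
    rw [integral_map (by fun_prop) (Measurable.of_discrete).aestronglyMeasurable]
  rw [h1, ← hstep, Measure.integral_compProd .of_finite,
    integral_map (by fun_prop) (Measurable.of_discrete).aestronglyMeasurable]
  refine integral_congr_ae (.of_forall fun x => ?_)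
  change ∫ b, φ (Preorder.frestrictLe t x) b ∂((π (x t)).1.toMeasure) = _
  rw [PMF.integral_eq_sum]
  rfl

/-- Almost every trajectory only makes steps of positive probability. -/
lemma ae_step_ne_zero : ∀ᵐ x ∂G.pathMeasure π, ∀ t, (π (x t)).1 (x (t + 1)) ≠ 0 := by
  classical
  rw [ae_all_iff]
  intro t
  have h := G.integral_step π t fun y j => if (π (y ⟨t, by simp⟩)).1 j = 0 then 1 else 0
  have h0 : ∀ x : ℕ → Fin n, G.expectationOp π (fun j =>
      if (π (Preorder.frestrictLe (π := fun _ => Fin n) t x ⟨t, by simp⟩)).1 j = 0 then 1 else 0)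
        (x t) = 0 := by
    intro x
    rw [expectationOp_apply]
    refine Finset.sum_eq_zero fun j _ => ?_
    by_cases hj : (π (x t)).1 j = 0
    · simp [hj]
    · simp [Preorder.frestrictLe_apply, hj]
  simp only [h0, integral_zero] at h
  rw [integral_eq_zero_iff_of_nonneg] at h
  · filter_upwards [h] with x hx hc
    simp [Preorder.frestrictLe_apply, hc] at hx
  · intro x
    dsimp only
    split_ifs <;> simp
  · exact G.integrable_frestrictLe_comp π (t + 1) (fun y =>
      if (π (y ⟨t, by simp⟩)).1 (y ⟨t + 1, by simp⟩) = 0 then 1 else 0)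

lemma ae_adj : ∀ᵐ x ∂G.pathMeasure π, ∀ t, G.graph.Adj (x t) (x (t + 1)) := by
  filter_upwards [G.ae_step_ne_zero π] with x hx t
  by_contra hc
  exact hx t ((π (x t)).2 _ hc)

lemma map_eval_zero_pathMeasure :
    (G.pathMeasure π).map (fun x => x 0) = G.prior.toMeasure := by
  have h : (fun x : ℕ → Fin n => x 0)
      = (fun y : ((i : Finset.Iic 0) → Fin n) => y ⟨0, by simp⟩) ∘ Preorder.frestrictLe 0 := rfl
  rw [h, ← Measure.map_map (by fun_prop) (by fun_prop), pathMeasure, Kernel.trajMeasure,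
    Measure.map_comp _ _ (by fun_prop), Kernel.traj_map_frestrictLe, Kernel.partialTraj_self,
    Measure.id_comp, Measure.map_map (by fun_prop) (by fun_prop)]
  exact Measure.map_id

/-! ### Almost sure existence of the asymptotic frequencies -/

/-- The weighted sum of the increments `g (X (k + 1)) - (P g) (X k)`. -/
def innovationSum (w : ℕ → ℝ) (g : Fin n → ℝ) (T : ℕ) (x : ℕ → Fin n) : ℝ :=
  ∑ k ∈ Finset.range T, w k * (g (x (k + 1)) - G.expectationOp π g (x k))

lemma innovationSum_succ (w : ℕ → ℝ) (g : Fin n → ℝ) (T : ℕ) (x : ℕ → Fin n) :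
    G.innovationSum π w g (T + 1) x = G.innovationSum π w g T x
      + w T * (g (x (T + 1)) - G.expectationOp π g (x T)) :=
  Finset.sum_range_succ _ _

lemma innovationSum_factors (w : ℕ → ℝ) (g : Fin n → ℝ) (T : ℕ) :
    ∃ ψ : ((i : Finset.Iic T) → Fin n) → ℝ,
      G.innovationSum π w g T = fun x => ψ (Preorder.frestrictLe T x) := by
  refine ⟨fun y => ∑ k : Fin T, w k * (g (y ⟨k + 1, by simp⟩)
    - G.expectationOp π g (y ⟨k, by simp⟩)), ?_⟩
  ext x
  rw [innovationSum, Finset.sum_range]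
  rfl

lemma integrable_innovationSum (w : ℕ → ℝ) (g : Fin n → ℝ) (T : ℕ) :
    Integrable (G.innovationSum π w g T) (G.pathMeasure π) := by
  obtain ⟨ψ, hψ⟩ := G.innovationSum_factors π w g T
  rw [hψ]
  exact G.integrable_frestrictLe_comp π T ψ

lemma integral_mul_innovation (g : Fin n → ℝ) (t : ℕ) (ψ : ((i : Finset.Iic t) → Fin n) → ℝ) :
    ∫ x, ψ (Preorder.frestrictLe t x) * (g (x (t + 1)) - G.expectationOp π g (x t))
      ∂G.pathMeasure π = 0 := by
  refine (G.integral_step π t fun y j =>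
    ψ y * (g j - G.expectationOp π g (y ⟨t, by simp⟩))).trans ?_
  refine integral_eq_zero_of_ae (.of_forall fun x => ?_)
  simp only [expectationOp_apply, Preorder.frestrictLe_apply, Pi.zero_apply]
  have h1 : ∀ j, ((π (x t)).1 j).toReal * (ψ (Preorder.frestrictLe t x) *
      (g j - ∑ k, ((π (x t)).1 k).toReal * g k)) = ψ (Preorder.frestrictLe t x) *
      (((π (x t)).1 j).toReal * g j
        - ((π (x t)).1 j).toReal * ∑ k, ((π (x t)).1 k).toReal * g k) := fun j => by ring
  simp only [h1]
  rw [← Finset.mul_sum, Finset.sum_sub_distrib, ← Finset.sum_mul, sum_strategy_toReal, one_mul,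
    sub_self, mul_zero]

lemma martingale_innovationSum (w : ℕ → ℝ) (g : Fin n → ℝ) :
    Martingale (G.innovationSum π w g) (Filtration.piLE (X := fun _ => Fin n))
      (G.pathMeasure π) := by
  refine martingale_of_setIntegral_eq_succ ?_ (G.integrable_innovationSum π w g) ?_
  · intro T
    obtain ⟨ψ, hψ⟩ := G.innovationSum_factors π w g T
    rw [hψ]
    refine Measurable.stronglyMeasurable ?_
    rw [Filtration.piLE_eq_comap_frestrictLe]
    exact (Measurable.of_discrete (f := ψ)).comp (comap_measurable _)
  · intro T s hs
    have hs' : MeasurableSet s := Filtration.piLE.le T s hs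
    rw [Filtration.piLE_eq_comap_frestrictLe] at hs
    obtain ⟨A, -, rfl⟩ := hs
    rw [← sub_eq_zero, ← integral_sub (G.integrable_innovationSum π w g T).integrableOn
      (G.integrable_innovationSum π w g (T + 1)).integrableOn, ← integral_indicator hs']
    have h := G.integral_mul_innovation π g T (A.indicator fun _ => - w T)
    rw [← h]
    congr 1 with x
    by_cases hx : Preorder.frestrictLe (π := fun _ => Fin n) T x ∈ A
    · rw [Set.indicator_of_mem (by exact hx), Set.indicator_of_mem hx, innovationSum_succ]
      ring
    · rw [Set.indicator_of_notMem (by exact hx), Set.indicator_of_notMem hx, zero_mul]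

lemma abs_innovation_le (g : Fin n → ℝ) (i j : Fin n) :
    |g j - G.expectationOp π g i| ≤ 2 * ‖g‖ := by
  have h1 := norm_le_pi_norm g j
  have h2 := (norm_le_pi_norm (G.expectationOp π g) i).trans (G.norm_expectationOp_le π g)
  have h3 := norm_sub_le (g j) (G.expectationOp π g i)
  rw [Real.norm_eq_abs] at h3
  linarith

lemma integral_innovationSum_sq_le (w : ℕ → ℝ) (g : Fin n → ℝ) (T : ℕ) :
    ∫ x, G.innovationSum π w g T x ^ 2 ∂G.pathMeasure π
      ≤ (∑ k ∈ Finset.range T, w k ^ 2) * (2 * ‖g‖) ^ 2 := by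
  induction T with
  | zero => simp [innovationSum]
  | succ T ih =>
    obtain ⟨ψ, hψ⟩ := G.innovationSum_factors π w g T
    obtain ⟨ψ', hψ'⟩ := G.innovationSum_factors π w g (T + 1)
    have h0 := G.integral_mul_innovation π g T fun y => 2 * w T * ψ y
    have hint0 : Integrable (fun x : ℕ → Fin n => 2 * w T * ψ (Preorder.frestrictLe T x) *
        (g (x (T + 1)) - G.expectationOp π g (x T))) (G.pathMeasure π) :=
      G.integrable_frestrictLe_comp π (T + 1) fun y =>
        2 * w T * ψ (fun i => y ⟨i, Finset.mem_Iic.mpr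
            ((Finset.mem_Iic.mp i.2).trans (Nat.le_succ T))⟩)
          * (g (y ⟨T + 1, by simp⟩) - G.expectationOp π g (y ⟨T, by simp⟩))
    have hint1 : Integrable (fun x => G.innovationSum π w g T x ^ 2) (G.pathMeasure π) := by
      rw [hψ]; exact G.integrable_frestrictLe_comp π T fun y => ψ y ^ 2
    have hint2 : Integrable (fun x => G.innovationSum π w g (T + 1) x ^ 2)
        (G.pathMeasure π) := by
      rw [hψ']; exact G.integrable_frestrictLe_comp π (T + 1) fun y => ψ' y ^ 2
    calc ∫ x, G.innovationSum π w g (T + 1) x ^ 2 ∂G.pathMeasure π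
        ≤ ∫ x, (G.innovationSum π w g T x ^ 2 + 2 * w T * ψ (Preorder.frestrictLe T x) *
            (g (x (T + 1)) - G.expectationOp π g (x T)) + w T ^ 2 * (2 * ‖g‖) ^ 2)
            ∂G.pathMeasure π := by
          refine integral_mono hint2 ((hint1.add hint0).add (integrable_const _)) fun x => ?_
          have h2 := sq_le_sq' (neg_le_of_abs_le (G.abs_innovation_le π g (x T) (x (T + 1))))
            (le_of_abs_le (G.abs_innovation_le π g (x T) (x (T + 1))))
          have h3 := mul_le_mul_of_nonneg_left h2 (sq_nonneg (w T))
          simp only [innovationSum_succ]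
          rw [← congrFun hψ x]
          nlinarith
      _ = ∫ x, G.innovationSum π w g T x ^ 2 ∂G.pathMeasure π + w T ^ 2 * (2 * ‖g‖) ^ 2 := by
          have h1 := integral_add (hint1.add hint0) (integrable_const (w T ^ 2 * (2 * ‖g‖) ^ 2))
          simp only [Pi.add_apply] at h1
          rw [h1, integral_add hint1 hint0, h0]
          simp
      _ ≤ _ := by rw [Finset.sum_range_succ, add_mul]; linarith

lemma ae_tendsto_innovationSum {w : ℕ → ℝ} {g : Fin n → ℝ} {R : ℝ}
    (hR : ∀ T, ∫ x, |G.innovationSum π w g T x| ∂G.pathMeasure π ≤ R) :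
    ∀ᵐ x ∂G.pathMeasure π, ∃ l, Tendsto (fun T => G.innovationSum π w g T x) atTop (nhds l) := by
  refine (G.martingale_innovationSum π w g).submartingale.exists_ae_tendsto_of_bdd
    (R := R.toNNReal) fun T => ?_
  rw [eLpNorm_one_eq_lintegral_enorm,
    ← ofReal_integral_norm_eq_lintegral_enorm (G.integrable_innovationSum π w g T)]
  exact ENNReal.ofReal_le_ofReal (hR T)

lemma ae_tendsto_innovationSum_div (g : Fin n → ℝ) :
    ∀ᵐ x ∂G.pathMeasure π, ∃ l, Tendsto
      (fun T => G.innovationSum π (fun k => ((k : ℝ) + 1)⁻¹) g T x) atTop (nhds l) := by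
  have hs : Summable fun k : ℕ => (((k : ℝ) + 1)⁻¹) ^ 2 := by
    have := (summable_nat_add_iff 1).mpr (Real.summable_nat_pow_inv (p := 2) |>.mpr (by norm_num))
    simpa using this
  refine G.ae_tendsto_innovationSum π
    (R := 1 + (∑' k : ℕ, (((k : ℝ) + 1)⁻¹) ^ 2) * (2 * ‖g‖) ^ 2) fun T => ?_
  obtain ⟨ψ, hψ⟩ := G.innovationSum_factors π (fun k => ((k : ℝ) + 1)⁻¹) g T
  have hint : Integrable (fun x => G.innovationSum π (fun k => ((k : ℝ) + 1)⁻¹) g T x ^ 2)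
      (G.pathMeasure π) := by
    rw [hψ]; exact G.integrable_frestrictLe_comp π T fun y => ψ y ^ 2
  calc ∫ x, |G.innovationSum π (fun k => ((k : ℝ) + 1)⁻¹) g T x| ∂G.pathMeasure π
      ≤ ∫ x, (1 + G.innovationSum π (fun k => ((k : ℝ) + 1)⁻¹) g T x ^ 2) ∂G.pathMeasure π := by
        refine integral_mono (G.integrable_innovationSum π _ g T).abs
          ((integrable_const _).add hint) fun x => ?_
        dsimp only
        rw [← sq_abs (G.innovationSum π _ g T x)]
        nlinarith [sq_nonneg (|G.innovationSum π (fun k => ((k : ℝ) + 1)⁻¹) g T x| - 1),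
          abs_nonneg (G.innovationSum π (fun k => ((k : ℝ) + 1)⁻¹) g T x)]
    _ = 1 + ∫ x, G.innovationSum π (fun k => ((k : ℝ) + 1)⁻¹) g T x ^ 2 ∂G.pathMeasure π := by
        rw [integral_add (integrable_const _) hint]; simp
    _ ≤ _ := by
        gcongr
        refine (G.integral_innovationSum_sq_le π _ g T).trans ?_
        gcongr
        exact hs.sum_le_tsum _ fun k _ => sq_nonneg _

lemma ae_tendsto_harmonic {h : Fin n → ℝ} (hh : G.expectationOp π h = h) :
    ∀ᵐ x ∂G.pathMeasure π, ∃ l, Tendsto (fun t => h (x t)) atTop (nhds l) := by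
  have hsum : ∀ T x, G.innovationSum π (fun _ => 1) h T x = h (x T) - h (x 0) := by
    intro T x
    simp only [innovationSum, hh, one_mul]
    exact Finset.sum_range_sub (fun k => h (x k)) T
  have hae := G.ae_tendsto_innovationSum π (w := fun _ => 1) (g := h) (R := 2 * ‖h‖) fun T => by
    have hb : ∀ x, |G.innovationSum π (fun _ => 1) h T x| ≤ 2 * ‖h‖ := fun x => by
      have := G.abs_innovation_le π h (x 0) (x T)
      rwa [hh, ← hsum T x] at this
    calc ∫ x, |G.innovationSum π (fun _ => 1) h T x| ∂G.pathMeasure π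
        ≤ ∫ _, 2 * ‖h‖ ∂G.pathMeasure π :=
          integral_mono (G.integrable_innovationSum π _ h T).abs (integrable_const _) hb
      _ = 2 * ‖h‖ := by simp
  filter_upwards [hae] with x ⟨l, hl⟩
  refine ⟨l + h (x 0), (hl.add_const (h (x 0))).congr fun T => ?_⟩
  rw [hsum]; ring

lemma ae_tendsto_average (f : Fin n → ℝ) :
    ∀ᵐ x ∂G.pathMeasure π, ∃ l, Tendsto
      (fun T : ℕ => (T : ℝ)⁻¹ * ∑ k ∈ Finset.range T, f (x (k + 1))) atTop (nhds l) := by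
  obtain ⟨h, g, hh, hf⟩ :=
    exists_fixed_add_coboundary (G.expectationOp π) (G.norm_expectationOp_le π) f
  filter_upwards [G.ae_tendsto_harmonic π hh, G.ae_tendsto_innovationSum_div π g]
    with x ⟨l, hl⟩ ⟨l', hl'⟩
  have h1 := (hl.comp (tendsto_add_atTop_nat 1)).cesaro
  have h2 := tendsto_average_zero_of_sum_div hl'
  have h3 : Tendsto (fun T : ℕ => (T : ℝ)⁻¹ *
      (G.expectationOp π g (x 0) - G.expectationOp π g (x T))) atTop (nhds 0) := by
    refine squeeze_zero_norm (a := fun T : ℕ => (T : ℝ)⁻¹ * (2 * ‖g‖)) (fun T => ?_) ?_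
    · rw [norm_mul, Real.norm_of_nonneg (by positivity)]
      gcongr
      refine (norm_sub_le _ _).trans ?_
      have := G.norm_expectationOp_le π g
      linarith [norm_le_pi_norm (G.expectationOp π g) (x 0),
        norm_le_pi_norm (G.expectationOp π g) (x T)]
    · simpa using (tendsto_inv_atTop_nhds_zero_nat (𝕜 := ℝ)).mul_const (2 * ‖g‖)
  refine ⟨l + 0 + 0, ((h1.add h2).add h3).congr fun T => ?_⟩
  rw [← mul_add, ← mul_add, ← Finset.sum_range_sub' (fun k => G.expectationOp π g (x k)),
    ← Finset.sum_add_distrib, ← Finset.sum_add_distrib]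
  congr 1
  refine Finset.sum_congr rfl fun k _ => ?_
  rw [hf]
  simp only [Function.comp_apply, Pi.add_apply, Pi.sub_apply]
  ring

end Game

lemma frequency_eq_sum_range {n : ℕ} (x : ℕ → Fin n) (i : Fin n) (T : ℕ) :
    frequency x i T = (T : ℝ)⁻¹ * ∑ k ∈ Finset.range T, if x (k + 1) = i then 1 else 0 := by
  rw [frequency, one_div, Finset.range_eq_Ico,
    Finset.sum_Ico_add' (fun t => if x t = i then (1 : ℝ) else 0) 0 T 1]
  rfl

lemma Game.ae_tendsto_frequency {n : ℕ} (G : Game n) (π : ∀ i, G.StochStrategy i) (i : Fin n) :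
    ∀ᵐ x ∂G.pathMeasure π, ∃ l, Tendsto (frequency x i) atTop (nhds l) := by
  filter_upwards [G.ae_tendsto_average π fun j => if j = i then 1 else 0] with x ⟨l, hl⟩
  exact ⟨l, hl.congr fun T => (frequency_eq_sum_range x i T).symm⟩

/-! ### Asymptotic frequencies of sequences -/

section Frequency

variable {n : ℕ} {x : ℕ → Fin n} {i : Fin n} {l : ℝ} {L : ℕ}

lemma frequency_nonneg (x : ℕ → Fin n) (i : Fin n) (T : ℕ) : 0 ≤ frequency x i T := by
  rw [frequency_eq_sum_range]
  refine mul_nonneg (by positivity) (Finset.sum_nonneg fun k _ => ?_)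
  split_ifs <;> simp

lemma sum_frequency (x : ℕ → Fin n) {T : ℕ} (hT : 0 < T) : ∑ i, frequency x i T = 1 := by
  simp only [frequency_eq_sum_range]
  rw [← Finset.mul_sum, Finset.sum_comm]
  simp only [Finset.sum_ite_eq, Finset.mem_univ, if_true, Finset.sum_const, Finset.card_range,
    nsmul_eq_mul, mul_one]
  exact inv_mul_cancel₀ (by positivity)

/-- If distinct visits to `i` are at least `L` steps apart, the frequency of `i` is at most
`1 / L`. -/
lemma frequency_limit_le (hL : 0 < L)
    (hsep : ∀ t k, 0 < k → k < L → x t = i → x (t + k) ≠ i)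
    (hl : Tendsto (frequency x i) atTop (nhds l)) : l ≤ 1 / L := by
  have hblock : ∀ s, ∑ j ∈ Finset.range L, (if x (s + j) = i then (1 : ℝ) else 0) ≤ 1 := by
    intro s
    rw [Finset.sum_boole]
    norm_cast
    rw [Finset.card_le_one]
    intro a ha b hb
    simp only [Finset.mem_filter, Finset.mem_range] at ha hb
    rcases lt_trichotomy a b with h | h | h
    · exact absurd (by rw [← hb.2]; congr 1; omega)
        (hsep (s + a) (b - a) (by omega) (by omega) ha.2)
    · exact h
    · exact absurd (by rw [← ha.2]; congr 1; omega)
        (hsep (s + b) (a - b) (by omega) (by omega) hb.2)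
  have hsum : ∀ m : ℕ, ∑ k ∈ Finset.range (L * m), (if x (k + 1) = i then (1 : ℝ) else 0)
      ≤ m := by
    intro m
    induction m with
    | zero => simp
    | succ m ih =>
      rw [Nat.mul_succ, Finset.sum_range_add]
      have h := hblock (L * m + 1)
      simp only [show ∀ j, L * m + 1 + j = L * m + j + 1 from fun j => by ring] at h
      push_cast
      linarith
  have hsub : Tendsto (fun m : ℕ => L * m) atTop atTop :=
    tendsto_id.const_mul_atTop' hL
  refine le_of_tendsto (hl.comp hsub) ?_
  filter_upwards [eventually_gt_atTop 0] with m hm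
  have h1 : (0 : ℝ) < L := by exact_mod_cast hL
  have h2 : (0 : ℝ) < m := by exact_mod_cast hm
  rw [Function.comp_apply, frequency_eq_sum_range, Nat.cast_mul]
  calc _ ≤ ((L : ℝ) * m)⁻¹ * m := by gcongr; exact hsum m
    _ = 1 / L := by field_simp

/-- If eventually every window of length `L` contains a visit to `i`, the frequency of `i` is at
least `1 / L`. -/
lemma le_frequency_limit (hL : 0 < L) {t₀ : ℕ}
    (hvis : ∀ t, t₀ ≤ t → ∃ k < L, x (t + k) = i)
    (hl : Tendsto (frequency x i) atTop (nhds l)) : 1 / L ≤ l := by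
  have hnn : ∀ k, (0 : ℝ) ≤ if x k = i then (1 : ℝ) else 0 := fun k => by split_ifs <;> simp
  have hsum : ∀ m : ℕ, (m : ℝ) - t₀
      ≤ ∑ k ∈ Finset.range (L * m), (if x (k + 1) = i then (1 : ℝ) else 0) := by
    intro m
    induction m with
    | zero => simp
    | succ m ih =>
      rcases lt_or_ge m t₀ with h | h
      · have h1 : ((m + 1 : ℕ) : ℝ) ≤ t₀ := by exact_mod_cast h
        exact (sub_nonpos.mpr h1).trans (Finset.sum_nonneg fun k _ => hnn _)
      · rw [Nat.mul_succ, Finset.sum_range_add]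
        obtain ⟨k, hk, hxk⟩ := hvis (L * m + 1) (by nlinarith)
        have h2 := Finset.single_le_sum
          (f := fun j => if x (L * m + j + 1) = i then (1 : ℝ) else 0)
          (fun j _ => hnn _) (Finset.mem_range.mpr hk)
        rw [show L * m + 1 + k = L * m + k + 1 by ring] at hxk
        simp only [hxk, if_true] at h2
        push_cast
        linarith
  have hsub : Tendsto (fun m : ℕ => L * m) atTop atTop :=
    tendsto_id.const_mul_atTop' hL
  have h1 : (0 : ℝ) < L := by exact_mod_cast hL
  have hlow : Tendsto (fun m : ℕ => 1 / (L : ℝ) - t₀ / L * (m : ℝ)⁻¹) atTop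
      (nhds (1 / (L : ℝ))) := by
    simpa using (((tendsto_inv_atTop_nhds_zero_nat (𝕜 := ℝ)).const_mul
      ((t₀ : ℝ) / L)).const_sub (1 / (L : ℝ)))
  refine le_of_tendsto_of_tendsto hlow (hl.comp hsub) ?_
  filter_upwards [eventually_gt_atTop 0] with m hm
  have h2 : (0 : ℝ) < m := by exact_mod_cast hm
  rw [Function.comp_apply, frequency_eq_sum_range, Nat.cast_mul]
  calc 1 / (L : ℝ) - t₀ / L * (m : ℝ)⁻¹ = ((L : ℝ) * m)⁻¹ * (m - t₀) := by field_simp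
    _ ≤ _ := by gcongr; exact hsum m

/-- If `i` is never revisited, its frequency vanishes. -/
lemma frequency_limit_eq_zero (h : ∀ t k, 0 < k → x t = i → x (t + k) ≠ i)
    (hl : Tendsto (frequency x i) atTop (nhds l)) : l = 0 := by
  refine le_antisymm ?_ (ge_of_tendsto' hl (frequency_nonneg x i))
  refine le_of_forall_pos_le_add fun ε hε => ?_
  obtain ⟨L, hL⟩ := exists_nat_one_div_lt hε
  have := frequency_limit_le (L := L + 1) L.succ_pos (fun t k hk _ => h t k hk) hl
  push_cast at this
  linarith

end Frequency

namespace Game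

variable {n : ℕ} (G : Game n) (π : ∀ i, G.StochStrategy i)

/-! ### Stochastic costs -/

lemma ae_tendsto_asymptoticFrequency : ∀ᵐ x ∂G.pathMeasure π, ∀ i,
    Tendsto (frequency x i) atTop (nhds (asymptoticFrequency x i)) := by
  rw [ae_all_iff]
  intro i
  filter_upwards [G.ae_tendsto_frequency π i] with x hx
  exact tendsto_nhds_limUnder hx

lemma measurable_frequency (i : Fin n) (T : ℕ) :
    Measurable fun x : ℕ → Fin n => frequency x i T := by
  simp only [frequency]
  refine (Finset.measurable_fun_sum _ fun t _ => ?_).const_mul _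
  exact (Measurable.of_discrete (f := fun j : Fin n => if j = i then (1 : ℝ) else 0)).comp
    (measurable_pi_apply t)

lemma asymptoticFrequency_mem_Icc {x : ℕ → Fin n} {i : Fin n}
    (hx : Tendsto (frequency x i) atTop (nhds (asymptoticFrequency x i))) :
    asymptoticFrequency x i ∈ Set.Icc (0 : ℝ) 1 := by
  refine ⟨ge_of_tendsto' hx (frequency_nonneg x i), ?_⟩
  simpa using frequency_limit_le one_pos (fun t k h1 h2 => by omega) hx

lemma integrable_asymptoticFrequency (i : Fin n) :
    Integrable (fun x => asymptoticFrequency x i) (G.pathMeasure π) := by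
  have hm : AEMeasurable (fun x => asymptoticFrequency x i) (G.pathMeasure π) :=
    aemeasurable_of_tendsto_metrizable_ae atTop
      (fun T => (measurable_frequency i T).aemeasurable)
      (by filter_upwards [G.ae_tendsto_asymptoticFrequency π] with x hx using hx i)
  refine Integrable.of_bound hm.aestronglyMeasurable 1 ?_
  filter_upwards [G.ae_tendsto_asymptoticFrequency π] with x hx
  have := asymptoticFrequency_mem_Icc (hx i)
  rw [Real.norm_eq_abs, abs_of_nonneg this.1]
  exact this.2

lemma stochCost_nonneg (i : Fin n) : 0 ≤ G.stochCost π i := by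
  refine integral_nonneg_of_ae ?_
  filter_upwards [G.ae_tendsto_asymptoticFrequency π] with x hx
  exact (asymptoticFrequency_mem_Icc (hx i)).1

lemma sum_stochCost : ∑ i, G.stochCost π i = 1 := by
  simp only [stochCost]
  rw [← integral_finsetSum _ fun i _ => G.integrable_asymptoticFrequency π i]
  have h : (fun x => ∑ i, asymptoticFrequency x i) =ᵐ[G.pathMeasure π] fun _ => 1 := by
    filter_upwards [G.ae_tendsto_asymptoticFrequency π] with x hx
    refine tendsto_nhds_unique (tendsto_finsetSum Finset.univ fun i _ => hx i) ?_
    refine tendsto_const_nhds.congr' ?_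
    filter_upwards [eventually_gt_atTop 0] with T hT
    exact (sum_frequency x hT).symm
  rw [integral_congr_ae h]
  simp

lemma integral_indicator_start (S : Set (Fin n)) (c : ℝ) :
    ∫ x, S.indicator (fun _ => c) (x 0) ∂G.pathMeasure π = G.prior.toMeasure.real S * c := by
  have h : ∫ v, S.indicator (fun _ => c) v ∂(G.pathMeasure π).map (fun x => x 0)
      = ∫ x, S.indicator (fun _ => c) (x 0) ∂G.pathMeasure π :=
    integral_map (measurable_pi_apply 0).aemeasurable (Measurable.of_discrete).aestronglyMeasurable
  rw [← h, map_eval_zero_pathMeasure, integral_indicator (MeasurableSet.of_discrete)]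
  simp

lemma integrable_indicator_start (S : Set (Fin n)) (c : ℝ) :
    Integrable (fun x : ℕ → Fin n => S.indicator (fun _ => c) (x 0)) (G.pathMeasure π) :=
  G.integrable_frestrictLe_comp π 0 fun y => S.indicator (fun _ => c) (y ⟨0, by simp⟩)

/-- If visits to `i` are `L` steps apart and only happen to trajectories starting in `S`, then
player `i` pays at most `prior S / L`. -/
lemma stochCost_le_of_separated {i : Fin n} {L : ℕ} (hL : 0 < L) (S : Set (Fin n))
    (hsep : ∀ᵐ x ∂G.pathMeasure π, ∀ t k, 0 < k → k < L → x t = i → x (t + k) ≠ i)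
    (hS : ∀ᵐ x ∂G.pathMeasure π, x 0 ∉ S → ∀ t, x t ≠ i) :
    G.stochCost π i ≤ G.prior.toMeasure.real S * (1 / L) := by
  rw [← G.integral_indicator_start π S]
  refine integral_mono_ae (G.integrable_asymptoticFrequency π i)
    (G.integrable_indicator_start π S _) ?_
  filter_upwards [G.ae_tendsto_asymptoticFrequency π, hsep, hS] with x hx h1 h2
  by_cases h : x 0 ∈ S
  · rw [Set.indicator_of_mem h]
    exact frequency_limit_le hL h1 (hx i)
  · rw [Set.indicator_of_notMem h]
    exact (frequency_limit_eq_zero (fun t k _ ht => absurd ht (h2 h t)) (hx i)).le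

/-- If trajectories starting in `S` eventually visit `i` in every window of length `L`, then
player `i` pays at least `prior S / L`. -/
lemma le_stochCost_of_visits {i : Fin n} {L : ℕ} (hL : 0 < L) (S : Set (Fin n))
    (hvis : ∀ᵐ x ∂G.pathMeasure π, x 0 ∈ S → ∃ t₀, ∀ t, t₀ ≤ t → ∃ k < L, x (t + k) = i) :
    G.prior.toMeasure.real S * (1 / L) ≤ G.stochCost π i := by
  rw [← G.integral_indicator_start π S]
  refine integral_mono_ae (G.integrable_indicator_start π S _)
    (G.integrable_asymptoticFrequency π i) ?_
  filter_upwards [G.ae_tendsto_asymptoticFrequency π, hvis] with x hx h1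
  by_cases h : x 0 ∈ S
  · rw [Set.indicator_of_mem h]
    obtain ⟨t₀, ht₀⟩ := h1 h
    exact le_frequency_limit hL ht₀ (hx i)
  · rw [Set.indicator_of_notMem h]
    exact (asymptoticFrequency_mem_Icc (hx i)).1

lemma stochCost_eq_zero {i : Fin n}
    (h : ∀ᵐ x ∂G.pathMeasure π, ∀ t k, 0 < k → x t = i → x (t + k) ≠ i) :
    G.stochCost π i = 0 := by
  refine integral_eq_zero_of_ae ?_
  filter_upwards [G.ae_tendsto_asymptoticFrequency π, h] with x hx h1
  exact frequency_limit_eq_zero h1 (hx i)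

lemma stochCost_le_half (i : Fin n) : G.stochCost π i ≤ 1 / 2 := by
  have h := G.stochCost_le_of_separated π (i := i) two_pos Set.univ (by
    filter_upwards [G.ae_adj π] with x hx t k h1 h2 ht hk
    obtain rfl : k = 1 := by omega
    have := hx t
    rw [ht, hk] at this
    exact G.loopless i this) (.of_forall fun x hx => absurd (Set.mem_univ _) hx)
  simpa using h

/-! ### Deterministic profiles as stochastic profiles -/

/-- The stochastic strategy that always plays a given out-neighbour. -/
noncomputable def pureStrategy {i : Fin n} (a : G.DetStrategy i) : G.StochStrategy i :=
  ⟨PMF.pure a, fun j hj => by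
    rw [PMF.pure_apply, if_neg]
    rintro rfl
    exact hj a.2⟩

/-- The stochastic profile in which everyone plays a pure strategy. -/
noncomputable def pureProfile (s : ∀ i, G.DetStrategy i) : ∀ i, G.StochStrategy i :=
  fun i => G.pureStrategy (s i)

lemma pureProfile_update (s : ∀ i, G.DetStrategy i) (i : Fin n) (a : G.DetStrategy i) :
    G.pureProfile (Function.update s i a)
      = Function.update (G.pureProfile s) i (G.pureStrategy a) := by
  ext1 j
  rcases eq_or_ne j i with rfl | h
  · simp [pureProfile]
  · simp [pureProfile, h]

lemma ae_step_of_pure {A : Set (Fin n)} {s : ∀ i, G.DetStrategy i}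
    (hπ : ∀ j ∈ A, π j = G.pureStrategy (s j)) :
    ∀ᵐ x ∂G.pathMeasure π, ∀ t, x t ∈ A → x (t + 1) = (s (x t) : Fin n) := by
  filter_upwards [G.ae_step_ne_zero π] with x hx t ht
  by_contra hc
  refine hx t ?_
  rw [hπ _ ht]
  exact (PMF.pure_apply _ _).trans (if_neg hc)

lemma ae_pureProfile (s : ∀ i, G.DetStrategy i) :
    ∀ᵐ x ∂G.pathMeasure (G.pureProfile s), x = G.detPath s (x 0) := by
  filter_upwards [G.ae_step_of_pure (G.pureProfile s) (A := Set.univ) fun j _ => rfl] with x hx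
  funext t
  induction t with
  | zero => rfl
  | succ t ih =>
    rw [hx t (Set.mem_univ _), ih, detPath, detPath, Function.iterate_succ_apply']

lemma detCost_eq_stochCost (s : ∀ i, G.DetStrategy i) (i : Fin n) :
    G.detCost s i = G.stochCost (G.pureProfile s) i := by
  have h : ∫ v, asymptoticFrequency (G.detPath s v) i
      ∂(G.pathMeasure (G.pureProfile s)).map (fun x => x 0)
      = ∫ x, asymptoticFrequency (G.detPath s (x 0)) i ∂G.pathMeasure (G.pureProfile s) :=
    integral_map (measurable_pi_apply 0).aemeasurable (Measurable.of_discrete).aestronglyMeasurable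
  rw [map_eval_zero_pathMeasure] at h
  rw [detCost, h, stochCost]
  refine integral_congr_ae ?_
  filter_upwards [G.ae_pureProfile s] with x hx
  rw [← hx]

lemma exists_tendsto_frequency_detPath (s : ∀ i, G.DetStrategy i) (v i : Fin n) :
    ∃ l : ℝ, Tendsto (frequency (G.detPath s v) i) atTop (nhds l) := by
  let G' : Game n := { G with prior := PMF.pure v }
  have h0 : ∀ᵐ x ∂G'.pathMeasure (G'.pureProfile s), x 0 = v := by
    have h : ∀ᵐ w ∂(G'.pathMeasure (G'.pureProfile s)).map (fun x => x 0), w = v := by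
      rw [map_eval_zero_pathMeasure]
      change ∀ᵐ w ∂(PMF.pure v).toMeasure, w = v
      rw [PMF.toMeasure_pure, ae_dirac_eq]
      rfl
    exact ae_of_ae_map (measurable_pi_apply 0).aemeasurable h
  obtain ⟨x, h1, h2, h3⟩ :=
    (h0.and ((G'.ae_pureProfile s).and (G'.ae_tendsto_frequency (G'.pureProfile s) i))).exists
  rw [h1] at h2
  rw [h2] at h3
  exact h3

end Game

/-! ### Bounds on the prices of anarchy and stability -/

section Price

variable {n : ℕ} {A : Fin n → Type*} {c : (∀ i, A i) → Fin n → ℝ}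

lemma le_socialCost (c : (∀ i, A i) → Fin n → ℝ) (s : ∀ i, A i) (i : Fin n) :
    c s i ≤ socialCost c s :=
  le_ciSup (Set.finite_range _).bddAbove i

lemma inv_card_le_socialCost (hn : 0 < n) {s : ∀ i, A i} (hsum : ∑ i, c s i = 1) :
    1 / (n : ℝ) ≤ socialCost c s := by
  have h : ∑ i, c s i ≤ ∑ _i : Fin n, socialCost c s :=
    Finset.sum_le_sum fun i _ => le_socialCost c s i
  rw [hsum, Finset.sum_const, Finset.card_univ, Fintype.card_fin, nsmul_eq_mul] at h
  rw [div_le_iff₀ (by positivity)]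
  linarith

lemma socialCost_le (hn : 0 < n) {s : ∀ i, A i} {b : ℝ} (hc : ∀ i, c s i ≤ b) :
    socialCost c s ≤ b :=
  have : Nonempty (Fin n) := ⟨⟨0, hn⟩⟩
  ciSup_le hc

lemma price_bounds (hn : 0 < n) (hne : (nashEquilibria c).Nonempty)
    (hsum : ∀ s, ∑ i, c s i = 1) (hhalf : ∀ s i, c s i ≤ 1 / 2) :
    priceOfStability c ≤ priceOfAnarchy c ∧ priceOfAnarchy c ≤ (n : ℝ) / 2 := by
  obtain ⟨s, hs⟩ := hne
  have hn' : (0 : ℝ) < n := by exact_mod_cast hn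
  have hlow : ∀ s, 1 / (n : ℝ) ≤ socialCost c s := fun s => inv_card_le_socialCost hn (hsum s)
  have hup : ∀ s, socialCost c s ≤ 1 / 2 := fun s => socialCost_le hn (hhalf s)
  have hinf : 1 / (n : ℝ) ≤ sInf (Set.range (socialCost c)) :=
    le_csInf ⟨_, s, rfl⟩ (by rintro _ ⟨s, rfl⟩; exact hlow s)
  have hpos : 0 < sInf (Set.range (socialCost c)) := lt_of_lt_of_le (by positivity) hinf
  have hsup : sSup (socialCost c '' nashEquilibria c) ≤ 1 / 2 :=
    csSup_le ⟨_, s, hs, rfl⟩ (by rintro _ ⟨s, -, rfl⟩; exact hup s)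
  constructor
  · refine div_le_div_of_nonneg_right ?_ hpos.le
    have hm : socialCost c s ∈ socialCost c '' nashEquilibria c := ⟨s, hs, rfl⟩
    exact (csInf_le ⟨1 / (n : ℝ), by rintro _ ⟨s, -, rfl⟩; exact hlow s⟩ hm).trans
      (le_csSup ⟨1 / 2, by rintro _ ⟨s, -, rfl⟩; exact hup s⟩ hm)
  · rw [priceOfAnarchy, div_le_iff₀ hpos]
    calc _ ≤ (1 : ℝ) / 2 := hsup
      _ = n / 2 * (1 / n) := by field_simp
      _ ≤ _ := by gcongr

lemma price_eq (hn : 0 < n) (hne : (nashEquilibria c).Nonempty)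
    (hsum : ∀ s, ∑ i, c s i = 1) (hNE : ∀ s ∈ nashEquilibria c, socialCost c s = 1 / 2)
    (hopt : ∃ s, ∀ i, c s i ≤ 1 / n) :
    priceOfStability c = (n : ℝ) / 2 ∧ priceOfAnarchy c = (n : ℝ) / 2 := by
  have hinf : sInf (Set.range (socialCost c)) = 1 / (n : ℝ) := by
    obtain ⟨s, hs⟩ := hopt
    refine IsLeast.csInf_eq ⟨⟨s, ?_⟩, ?_⟩
    · exact le_antisymm (socialCost_le hn hs) (inv_card_le_socialCost hn (hsum s))
    · rintro _ ⟨s, rfl⟩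
      exact inv_card_le_socialCost hn (hsum s)
  have himg : socialCost c '' nashEquilibria c = {1 / 2} := by
    obtain ⟨s, hs⟩ := hne
    ext r
    refine ⟨?_, ?_⟩
    · rintro ⟨s, hs, rfl⟩
      exact hNE s hs
    · rintro rfl
      exact ⟨s, hs, hNE s hs⟩
  have hn' : (0 : ℝ) < n := by exact_mod_cast hn
  rw [priceOfStability, priceOfAnarchy, himg, hinf, csInf_singleton, csSup_singleton]
  constructor <;> field_simp

end Price

/-! ### A potential for functional graphs -/

section Potential

variable {α : Type*} {f g : α → α} {i j v w : α}

/-- Two points are joinable if their forward orbits meet. -/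
def Joinable (f : α → α) (v w : α) : Prop := ∃ a b : ℕ, f^[a] v = f^[b] w

lemma Joinable.symm (h : Joinable f v w) : Joinable f w v :=
  let ⟨a, b, hab⟩ := h
  ⟨b, a, hab.symm⟩

lemma Joinable.trans {u : α} (h : Joinable f v w) (h' : Joinable f w u) : Joinable f v u := by
  obtain ⟨a, b, hab⟩ := h
  obtain ⟨c, d, hcd⟩ := h'
  refine ⟨c + a, b + d, ?_⟩
  rw [Function.iterate_add_apply, hab, ← Function.iterate_add_apply, add_comm c b,
    Function.iterate_add_apply, hcd, ← Function.iterate_add_apply]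

lemma iterate_eq_of_avoid (hfg : ∀ u, u ≠ i → g u = f u) {k : ℕ}
    (h : ∀ m < k, f^[m] v ≠ i) : g^[k] v = f^[k] v := by
  induction k with
  | zero => rfl
  | succ k ih =>
    rw [Function.iterate_succ_apply', ih fun m hm => h m (by omega), hfg _ (h k (by omega)),
      Function.iterate_succ_apply']

lemma exists_first_hit (h : ∃ k, f^[k] v = i) :
    ∃ k, f^[k] v = i ∧ ∀ m < k, f^[m] v ≠ i := by
  classical
  exact ⟨Nat.find h, Nat.find_spec h, fun m hm => Nat.find_min h hm⟩

lemma reaches_of_reaches (hfg : ∀ u, u ≠ i → g u = f u) (h : ∃ k, f^[k] v = i) :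
    ∃ k, g^[k] v = i := by
  obtain ⟨k, hk, hm⟩ := exists_first_hit h
  exact ⟨k, (iterate_eq_of_avoid hfg hm).trans hk⟩

/-- Redirecting a periodic point does not separate joinable points. -/
lemma Joinable.of_redirect (hfg : ∀ u, u ≠ i → g u = f u) (hi : i ∈ Function.periodicPts f)
    (h : Joinable f v w) : Joinable g v w := by
  have hstep : ∀ u, Joinable g u (f u) := by
    intro u
    by_cases hu : u = i
    · subst hu
      obtain ⟨p, hp, hpi⟩ := hi
      obtain ⟨k, hk⟩ := reaches_of_reaches (v := f u) hfg ⟨p - 1, by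
        rw [← Function.iterate_succ_apply, Nat.succ_eq_add_one, Nat.sub_add_cancel hp]
        exact hpi⟩
      exact ⟨0, k, hk.symm⟩
    · exact ⟨1, 0, hfg u hu⟩
  have hiter : ∀ a u, Joinable g u (f^[a] u) := by
    intro a
    induction a with
    | zero => exact fun u => ⟨0, 0, rfl⟩
    | succ a ih => exact fun u => (hstep u).trans (ih (f u))
  obtain ⟨a, b, hab⟩ := h
  have h1 := hiter a v
  rw [hab] at h1
  exact h1.trans (hiter b w).symm

lemma reaches_of_joinable (hi : i ∈ Function.periodicPts f) (h : Joinable f i j) :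
    ∃ k, f^[k] j = i := by
  obtain ⟨a, b, hab⟩ := h
  obtain ⟨p, hp, hpi⟩ := hi
  have h1 : f^[p * a] i = i := hpi.mul_const a
  refine ⟨p * a - a + b, ?_⟩
  rw [Function.iterate_add_apply, ← hab, ← Function.iterate_add_apply,
    Nat.sub_add_cancel (Nat.le_mul_of_pos_left a hp), h1]

/-- The length of the cycle that the orbit of `v` ends in (`0` if there is none). -/
noncomputable def eventualPeriod (f : α → α) (v : α) : ℕ :=
  sInf {p | 0 < p ∧ ∃ a, f^[p + a] v = f^[a] v}

lemma eventualPeriod_le {p a : ℕ} (hp : 0 < p) (h : f^[p + a] v = f^[a] v) :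
    eventualPeriod f v ≤ p :=
  Nat.sInf_le ⟨hp, a, h⟩

lemma lt_eventualPeriod {L p : ℕ} (hv : ∃ k, f^[k] v = i) (hp : 0 < p) (hpi : f^[p] i = i)
    (hL : ∀ m, 0 < m → m ≤ L → f^[m] i ≠ i) : L < eventualPeriod f v := by
  obtain ⟨k, hk⟩ := hv
  have hne : {p | 0 < p ∧ ∃ a, f^[p + a] v = f^[a] v}.Nonempty :=
    ⟨p, hp, k, by rw [Function.iterate_add_apply, hk, hpi]⟩
  obtain ⟨hq, a, ha⟩ := Nat.sInf_mem hne
  change 0 < eventualPeriod f v at hq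
  change f^[eventualPeriod f v + a] v = _ at ha
  set q := eventualPeriod f v
  by_contra hlt
  refine hL q hq (not_lt.mp hlt) ?_
  have h1 : f^[q] (f^[a] i) = f^[a] i := by
    rw [← hk, ← Function.iterate_add_apply, ← Function.iterate_add_apply,
      ← Function.iterate_add_apply, add_comm (q + a) k, add_comm a k,
      Function.iterate_add_apply, ha, ← Function.iterate_add_apply]
  obtain ⟨c, hc⟩ := reaches_of_joinable (f := f) (i := i) (j := f^[a] i) ⟨p, hp, hpi⟩ ⟨a, 0, rfl⟩
  rw [← hc, ← Function.iterate_add_apply, add_comm, Function.iterate_add_apply, h1]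

variable [Fintype α]

open Classical in
/-- Lexicographic potential: first merge components, then lengthen cycles. -/
noncomputable def potential (f : α → α) : ℕ ×ₗ ℕ :=
  toLex ((Finset.univ.filter fun p : α × α => Joinable f p.1 p.2).card,
    ∑ v, eventualPeriod f v)

variable [DecidableEq α]

/-- Redirecting a periodic point to a point from which she is not reached within her period
increases the potential. -/
lemma potential_lt_update (hi : i ∈ Function.periodicPts f)
    (hj : ∀ k < Function.minimalPeriod f i, f^[k] j ≠ i) :
    potential f < potential (Function.update f i j) := by
  classical
  set g := Function.update f i j with hg
  have hfg : ∀ u, u ≠ i → g u = f u := fun u hu => Function.update_of_ne hu _ _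
  have hgi : g i = j := Function.update_self _ _ _
  have hsub : (Finset.univ.filter fun p : α × α => Joinable f p.1 p.2)
      ⊆ Finset.univ.filter fun p : α × α => Joinable g p.1 p.2 :=
    Finset.monotone_filter_right _ fun p _ hp => Joinable.of_redirect hfg hi hp
  rw [potential, potential, Prod.Lex.toLex_lt_toLex]
  by_cases hr : ∃ k, f^[k] j = i
  · rcases (Finset.card_le_card hsub).lt_or_eq with h | h
    · exact Or.inl h
    refine Or.inr ⟨h, ?_⟩
    obtain ⟨k, hk, hmin⟩ := exists_first_hit hr
    have hLk : Function.minimalPeriod f i ≤ k := by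
      by_contra hc
      exact hj k (not_le.mp hc) hk
    have hgit : ∀ m ≤ k, g^[m + 1] i = f^[m] j := fun m hm => by
      rw [Function.iterate_succ_apply, hgi]
      exact iterate_eq_of_avoid hfg fun m' hm' => hmin m' (by omega)
    have hlt : ∀ v, (∃ k, f^[k] v = i) → eventualPeriod f v < eventualPeriod g v := by
      intro v hv
      refine lt_of_le_of_lt (b := Function.minimalPeriod f i) ?_ ?_
      · obtain ⟨a, ha⟩ := hv
        refine eventualPeriod_le (a := a) (Function.minimalPeriod_pos_of_mem_periodicPts hi) ?_
        rw [Function.iterate_add_apply, ha, Function.iterate_minimalPeriod]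
      · refine lt_eventualPeriod (reaches_of_reaches hfg hv) k.succ_pos
          ((hgit k le_rfl).trans hk) fun m hm hmL => ?_
        rw [show m = m - 1 + 1 by omega, hgit _ (by omega)]
        exact hmin _ (by omega)
    refine Finset.sum_lt_sum (fun v _ => ?_) ⟨i, Finset.mem_univ _, hlt i ⟨0, rfl⟩⟩
    by_cases hv : ∃ k, f^[k] v = i
    · exact (hlt v hv).le
    · have h1 : ∀ m, g^[m] v = f^[m] v := fun m =>
        iterate_eq_of_avoid hfg fun m' _ h' => hv ⟨m', h'⟩
      simp only [eventualPeriod, h1, le_refl]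
  · refine Or.inl (Finset.card_lt_card (hsub.ssubset_of_mem_notMem (a := (i, j)) ?_ ?_))
    · exact Finset.mem_filter.mpr ⟨Finset.mem_univ _, 1, 0, hgi⟩
    · exact fun h => hr (reaches_of_joinable hi (Finset.mem_filter.mp h).2)

end Potential

namespace Game

variable {n : ℕ} (G : Game n)

lemma player_count_pos (G : Game n) : 0 < n := by
  obtain ⟨v, -⟩ := G.prior.support_nonempty
  exact v.pos

/-- There is a deterministic profile in which every periodic player is reached, from each of her
out-neighbours, in less time than her period. -/
lemma exists_locally_longest : ∃ s : ∀ i, G.DetStrategy i,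
    ∀ i ∈ Function.periodicPts (fun v => (s v : Fin n)), ∀ j, G.graph.Adj i j →
      ∃ k < Function.minimalPeriod (fun v => (s v : Fin n)) i,
        (fun v => (s v : Fin n))^[k] j = i := by
  have : Nonempty (∀ i, G.DetStrategy i) :=
    ⟨fun i => ⟨(G.exists_out i).choose, (G.exists_out i).choose_spec⟩⟩
  obtain ⟨s, hs⟩ := Finite.exists_max
    fun s : ∀ i, G.DetStrategy i => potential fun v => (s v : Fin n)
  refine ⟨s, fun i hi j hij => ?_⟩
  by_contra! hc
  have h1 := potential_lt_update hi hc
  have h2 := hs (Function.update s i ⟨j, hij⟩)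
  have h3 : (fun v => (Function.update s i ⟨j, hij⟩ v : Fin n))
      = Function.update (fun v => (s v : Fin n)) i j := by
    ext1 v
    rcases eq_or_ne v i with rfl | h
    · simp
    · simp [h]
  rw [h3] at h2
  exact absurd h1 (not_lt.mpr h2)

lemma exists_pureProfile_mem_nashEquilibria :
    ∃ s, G.pureProfile s ∈ nashEquilibria G.stochCost := by
  obtain ⟨s, hs⟩ := G.exists_locally_longest
  refine ⟨s, fun i a => not_lt.mpr ?_⟩
  set f : Fin n → Fin n := fun v => (s v : Fin n) with hf
  have hpath : ∀ᵐ x ∂G.pathMeasure (G.pureProfile s), ∀ t k, x (t + k) = f^[k] (x t) := by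
    filter_upwards [G.ae_pureProfile s] with x hx t k
    rw [hx, add_comm]
    exact Function.iterate_add_apply f k t _
  by_cases hi : i ∈ Function.periodicPts f
  · have hL := Function.minimalPeriod_pos_of_mem_periodicPts hi
    set L := Function.minimalPeriod f i
    set S : Set (Fin n) := {v | ∃ k, f^[k] v = i}
    refine (G.stochCost_le_of_separated _ hL S ?_ ?_).trans
      (G.le_stochCost_of_visits _ hL S ?_)
    · filter_upwards [hpath] with x hx t k hk hkL ht
      rw [hx, ht]
      exact Function.not_isPeriodicPt_of_pos_of_lt_minimalPeriod hk.ne' hkL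
    · filter_upwards [hpath] with x hx h0 t ht
      refine h0 ⟨t, ?_⟩
      rw [← hx, zero_add, ht]
    · filter_upwards [G.ae_adj _, G.ae_step_of_pure _ (A := {i}ᶜ) (s := s)
        fun j hj => Function.update_of_ne hj a (G.pureProfile s)] with x hadj hx
      have hx' : ∀ t, x t ≠ i → x (t + 1) = f (x t) := fun t ht => hx t ht
      have hhit : ∀ k t, f^[k] (x t) = i → ∃ k' ≤ k, x (t + k') = i := by
        intro k
        induction k with
        | zero => exact fun t ht => ⟨0, le_rfl, ht⟩
        | succ k ih =>
          intro t ht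
          by_cases hti : x t = i
          · exact ⟨0, Nat.zero_le _, hti⟩
          · rw [Function.iterate_succ_apply, ← hx' t hti] at ht
            obtain ⟨k', hk', h⟩ := ih (t + 1) ht
            exact ⟨k' + 1, by omega, by rwa [← add_assoc, add_right_comm]⟩
      rintro ⟨k₀, hk₀⟩
      obtain ⟨t₀, -, ht₀⟩ := hhit k₀ 0 hk₀
      rw [zero_add] at ht₀
      refine ⟨t₀, fun t ht => ?_⟩
      have hinv : ∃ k < L, f^[k] (x t) = i := by
        induction t, ht using Nat.le_induction with
        | base => exact ⟨0, hL, ht₀⟩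
        | succ t _ ih =>
          by_cases hti : x t = i
          · exact hs i hi _ (hti ▸ hadj t)
          · obtain ⟨k, hk, hki⟩ := ih
            cases k with
            | zero => exact absurd hki hti
            | succ k =>
              rw [Function.iterate_succ_apply, ← hx' t hti] at hki
              exact ⟨k, by omega, hki⟩
      obtain ⟨k, hk, hki⟩ := hinv
      obtain ⟨k', hk', h⟩ := hhit k t hki
      exact ⟨k', by omega, h⟩
  · rw [G.stochCost_eq_zero (G.pureProfile s)]
    · exact G.stochCost_nonneg _ i
    · filter_upwards [hpath] with x hx t k hk ht htk
      refine hi ⟨k, hk, ?_⟩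
      rw [hx, ht] at htk
      exact htk

lemma mem_nashEquilibria_detCost_of_pureProfile {s : ∀ i, G.DetStrategy i}
    (hs : G.pureProfile s ∈ nashEquilibria G.stochCost) : s ∈ nashEquilibria G.detCost := by
  intro i a
  rw [detCost_eq_stochCost, detCost_eq_stochCost, pureProfile_update]
  exact hs i _

lemma nonempty_nashEquilibria_stochCost : (nashEquilibria G.stochCost).Nonempty :=
  let ⟨_, hs⟩ := G.exists_pureProfile_mem_nashEquilibria
  ⟨_, hs⟩

lemma nonempty_nashEquilibria_detCost : (nashEquilibria G.detCost).Nonempty :=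
  let ⟨s, hs⟩ := G.exists_pureProfile_mem_nashEquilibria
  ⟨s, G.mem_nashEquilibria_detCost_of_pureProfile hs⟩

end Game

/-! ### The extremal instance -/

section Extremal

/-- Complete digraph in which the first two players only play with each other; the buck is
initially given to a uniformly random player. -/
noncomputable def extremalGame (n : ℕ) (hn : 4 ≤ n) : Game n where
  graph := { Adj := fun v w => v ≠ w ∧ ((v : ℕ) < 2 → (w : ℕ) < 2) }
  loopless i h := h.1 rfl
  exists_out i := by
    by_cases h : (i : ℕ) = 0
    · exact ⟨⟨1, by omega⟩, fun h' => by simp [h'] at h, fun _ => Nat.one_lt_two⟩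
    · exact ⟨⟨0, by omega⟩, fun h' => by simp [h'] at h, fun _ => Nat.two_pos⟩
  prior := haveI : Nonempty (Fin n) := ⟨⟨0, by omega⟩⟩; PMF.uniformOfFintype (Fin n)

variable {n : ℕ} (hn : 4 ≤ n)

/-- Pass the buck to the next player within `{0, 1}` and within `{2, …, n - 1}`, cyclically. -/
def extremalRotation (v : Fin n) : Fin n :=
  ⟨if (v : ℕ) = 0 then 1 else if (v : ℕ) = 1 then 0 else if (v : ℕ) + 1 = n then 2 else v + 1, by
    have := v.2
    split_ifs <;> omega⟩

lemma extremalRotation_injective : Function.Injective (extremalRotation hn) := by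
  intro v w h
  have h' := congrArg Fin.val h
  simp only [extremalRotation] at h'
  have := v.2
  have := w.2
  ext
  split_ifs at h' <;> omega

lemma extremalGame_adj_rotation (v : Fin n) :
    (extremalGame n hn).graph.Adj v (extremalRotation hn v) := by
  refine ⟨fun h => ?_, fun h => ?_⟩
  · have h' := congrArg Fin.val h
    simp only [extremalRotation] at h'
    split_ifs at h' <;> omega
  · simp only [extremalRotation]
    split_ifs <;> omega

lemma extremalGame_detCost_rotation (i : Fin n) :
    (extremalGame n hn).detCost
      (fun v => ⟨extremalRotation hn v, extremalGame_adj_rotation hn v⟩) i = 1 / n := by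
  set G := extremalGame n hn
  set s : ∀ i, G.DetStrategy i :=
    fun v => ⟨extremalRotation hn v, extremalGame_adj_rotation hn v⟩
  have hlim : Tendsto (fun T => ∑ v, frequency (G.detPath s v) i T) atTop
      (nhds (∑ v, asymptoticFrequency (G.detPath s v) i)) :=
    tendsto_finsetSum _ fun v _ =>
      tendsto_nhds_limUnder (G.exists_tendsto_frequency_detPath s v i)
  have hone : ∑ v, asymptoticFrequency (G.detPath s v) i = 1 := by
    refine tendsto_nhds_unique hlim (tendsto_const_nhds.congr' ?_)
    filter_upwards [eventually_gt_atTop 0] with T hT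
    simp only [frequency_eq_sum_range]
    rw [← Finset.mul_sum, Finset.sum_comm]
    have hcol : ∀ t, ∑ v, (if G.detPath s v t = i then (1 : ℝ) else 0) = 1 := by
      intro t
      have hbij : Function.Bijective fun v => G.detPath s v t :=
        Finite.injective_iff_bijective.mp ((extremalRotation_injective hn).iterate t)
      rw [hbij.sum_comp fun w => if w = i then (1 : ℝ) else 0]
      simp
    simp only [hcol]
    simp only [Finset.sum_const, Finset.card_range, nsmul_eq_mul, mul_one]
    exact (inv_mul_cancel₀ (by positivity)).symm
  rw [Game.detCost, PMF.integral_eq_sum]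
  have hprior : ∀ v, (G.prior v).toReal = (n : ℝ)⁻¹ := by
    intro v
    simp [G, extremalGame]
  simp only [show ∀ v, ((extremalGame n hn).prior v).toReal = (n : ℝ)⁻¹ from hprior, smul_eq_mul]
  rw [← Finset.mul_sum, one_div]
  exact (congrArg _ hone).trans (mul_one _)

/-- A player outside `{0, 1}` who passes the buck to player `0` never gets it back. -/
lemma extremalGame_stochCost_eq_zero {π : ∀ i, (extremalGame n hn).StochStrategy i} {i : Fin n}
    (hi : 2 ≤ (i : ℕ)) {a : (extremalGame n hn).DetStrategy i} (ha : ((a : Fin n) : ℕ) = 0)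
    (hπ : π i = (extremalGame n hn).pureStrategy a) :
    (extremalGame n hn).stochCost π i = 0 := by
  refine Game.stochCost_eq_zero _ π ?_
  have hstep : ∀ᵐ x ∂(extremalGame n hn).pathMeasure π, ∀ t, x t = i → x (t + 1) = (a : Fin n) := by
    filter_upwards [(extremalGame n hn).ae_step_ne_zero π] with x hx t ht
    by_contra hc
    refine hx t ?_
    rw [ht, hπ]
    exact (PMF.pure_apply _ _).trans (if_neg hc)
  filter_upwards [hstep, (extremalGame n hn).ae_adj π] with x hx hadj t k hk ht hkt
  have hlow : ∀ m, ((x (t + 1 + m) : Fin n) : ℕ) < 2 := by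
    intro m
    induction m with
    | zero => rw [add_zero, hx t ht, ha]; exact Nat.two_pos
    | succ m ih => exact (hadj (t + 1 + m)).2 ih
  have := hlow (k - 1)
  rw [show t + 1 + (k - 1) = t + k by omega, hkt] at this
  omega

lemma socialCost_eq_half_of_vanishing (hn : 4 ≤ n) {A : Fin n → Type*} {c : (∀ i, A i) → Fin n → ℝ}
    {s : ∀ i, A i} (hsum : ∑ i, c s i = 1) (hhalf : ∀ i, c s i ≤ 1 / 2)
    (hzero : ∀ i : Fin n, 2 ≤ (i : ℕ) → c s i = 0) : socialCost c s = 1 / 2 := by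
  obtain ⟨m, rfl⟩ : ∃ m, n = m + 2 := ⟨n - 2, by omega⟩
  refine le_antisymm (socialCost_le (by omega) hhalf) ?_
  rw [Fin.sum_univ_succ, Fin.sum_univ_succ, Finset.sum_eq_zero fun j _ => hzero _ (by simp)] at hsum
  have h0 := le_socialCost c s 0
  have h1 := hhalf (Fin.succ 0)
  linarith

/-- The link from any player outside `{0, 1}` to player `0`. -/
def extremalExit {i : Fin n} (hi : 2 ≤ (i : ℕ)) : (extremalGame n hn).DetStrategy i :=
  ⟨⟨0, by omega⟩, fun h => by simp [h] at hi, fun _ => Nat.two_pos⟩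

lemma extremalGame_stochCost_socialCost {π : ∀ i, (extremalGame n hn).StochStrategy i}
    (hπ : π ∈ nashEquilibria (extremalGame n hn).stochCost) :
    socialCost (extremalGame n hn).stochCost π = 1 / 2 := by
  refine socialCost_eq_half_of_vanishing hn (Game.sum_stochCost _ π) (Game.stochCost_le_half _ π)
    fun i hi => ?_
  refine le_antisymm ?_ (Game.stochCost_nonneg _ π i)
  have h := hπ i ((extremalGame n hn).pureStrategy (extremalExit hn hi))
  rwa [extremalGame_stochCost_eq_zero hn hi (a := extremalExit hn hi) rfl
    (Function.update_self _ _ _), not_lt] at h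

lemma extremalGame_detCost_socialCost {s : ∀ i, (extremalGame n hn).DetStrategy i}
    (hs : s ∈ nashEquilibria (extremalGame n hn).detCost) :
    socialCost (extremalGame n hn).detCost s = 1 / 2 := by
  refine socialCost_eq_half_of_vanishing hn ?_ (fun i => ?_) fun i hi => ?_
  · simp only [Game.detCost_eq_stochCost, Game.sum_stochCost]
  · rw [Game.detCost_eq_stochCost]
    exact Game.stochCost_le_half _ _ i
  · have h := hs i (extremalExit hn hi)
    rw [Game.detCost_eq_stochCost, Game.detCost_eq_stochCost, Game.pureProfile_update,
      extremalGame_stochCost_eq_zero hn hi (a := extremalExit hn hi) rfl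
      (Function.update_self _ _ _), not_lt] at h
    rw [Game.detCost_eq_stochCost]
    exact le_antisymm h (Game.stochCost_nonneg _ _ i)

end Extremal

end BuckPassing

open BuckPassing in
theorem mainTheorem9 :
    (∀ (n : ℕ) (G : Game n),
      -- the costs are well defined: the asymptotic frequencies exist (almost surely)
      ((∀ (s : ∀ i, G.DetStrategy i) (v i : Fin n),
          ∃ l : ℝ, Tendsto (frequency (G.detPath s v) i) atTop (nhds l)) ∧
        (∀ (π : ∀ i, G.StochStrategy i) (i : Fin n),
          ∀ᵐ x ∂G.pathMeasure π, ∃ l : ℝ, Tendsto (frequency x i) atTop (nhds l))) ∧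
      -- the deterministic game
      ((nashEquilibria G.detCost).Nonempty ∧
        priceOfStability G.detCost ≤ priceOfAnarchy G.detCost ∧
        priceOfAnarchy G.detCost ≤ (n : ℝ) / 2) ∧
      -- the stochastic game
      ((nashEquilibria G.stochCost).Nonempty ∧
        priceOfStability G.stochCost ≤ priceOfAnarchy G.stochCost ∧
        priceOfAnarchy G.stochCost ≤ (n : ℝ) / 2)) ∧
    -- tightness
    (∀ n : ℕ, 4 ≤ n → ∃ G : Game n,
      priceOfStability G.detCost = (n : ℝ) / 2 ∧ priceOfAnarchy G.detCost = (n : ℝ) / 2 ∧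
      priceOfStability G.stochCost = (n : ℝ) / 2 ∧
      priceOfAnarchy G.stochCost = (n : ℝ) / 2) := by
  have hsum : ∀ {n : ℕ} (G : Game n) s, ∑ i, G.detCost s i = 1 := fun G s => by
    simp only [Game.detCost_eq_stochCost, Game.sum_stochCost]
  refine ⟨fun n G => ⟨⟨G.exists_tendsto_frequency_detPath, G.ae_tendsto_frequency⟩,
    ⟨G.nonempty_nashEquilibria_detCost, price_bounds G.player_count_pos
      G.nonempty_nashEquilibria_detCost (hsum G) fun s i => ?_⟩,
    ⟨G.nonempty_nashEquilibria_stochCost, price_bounds G.player_count_pos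
      G.nonempty_nashEquilibria_stochCost G.sum_stochCost G.stochCost_le_half⟩⟩, fun n hn => ?_⟩
  · rw [Game.detCost_eq_stochCost]
    exact G.stochCost_le_half _ i
  · set G := extremalGame n hn
    have hdet := price_eq (c := G.detCost) (by omega) G.nonempty_nashEquilibria_detCost (hsum G)
      (fun s hs => extremalGame_detCost_socialCost hn hs)
      ⟨_, fun i => (extremalGame_detCost_rotation hn i).le⟩
    have hstoch := price_eq (c := G.stochCost) (by omega) G.nonempty_nashEquilibria_stochCost
      G.sum_stochCost (fun π hπ => extremalGame_stochCost_socialCost hn hπ)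
      ⟨_, fun i => ((G.detCost_eq_stochCost _ i).symm.trans
        (extremalGame_detCost_rotation hn i)).le⟩
    exact ⟨G, hdet.1, hdet.2, hstoch.1, hstoch.2⟩
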